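/- Let $m\ge 2$ and let $X_1,\dots,X_m$ be non-empty quandles such that the inner automorphism group $\operatorname{Inn}(X_i)$ (the group of permutations of $X_i$ generated by the maps $S_x\colon y\mapsto y*x$, $x\in X_i$) is amenable for at least one $i$, that is, it admits a finitely additive left-invariant probability measure defined on all of its subsets. Let $X=X_1*\cdots*X_m$ be the free product, i.e. the coproduct of $X_1,\dots,X_m$ in the category of quandles. Then the real vector space $H^2_b(X,\mathbb{R})$ is infinite dimensional. Here $H^n_b(X,\mathbb{R})$ denotes the bounded quandle cohomology of $X$, that is, the cohomology of the complex whose $n$-cochains are the bounded functions $f\colon X^n\to\mathbb{R}$ satisfying $f(x_1,\dots,x_n)=0$ whenever $x_i=x_{i+1}$ for some $i$, with coboundary $$\delta f(x_1,\dots,x_{n+1})=\sum_{i=1}^{n+1}(-1)^i\bigl(f(x_1,\dots,x_{i-1},x_{i+1},\dots,x_{n+1})-f(x_1*x_i,\dots,x_{i-1}*x_i,x_{i+1},\dots,x_{n+1})\bigr).$$ -/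

import Mathlib

open scoped Quandles

universe u v w

/-!
Mathlib writes the quandle operation as a left action: `y ◃ x` is the image of `x` under the
symmetry `S_y`. In the right-handed notation, `x * y = S_y(x)` is `y ◃ x`.
-/

/-- A (discrete) group is amenable if it carries a finitely additive, left-invariant probability
measure defined on all of its subsets. -/
def IsAmenableGroup (G : Type u) [Group G] : Prop :=
  ∃ μ : Set G → ℝ,
    (∀ A, 0 ≤ μ A) ∧
    μ Set.univ = 1 ∧
    (∀ A B, Disjoint A B → μ (A ∪ B) = μ A + μ B) ∧
    ∀ (g : G) (A : Set G), μ ((fun x => g * x) '' A) = μ A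

/-- The inner automorphism group of a rack: the group of permutations generated by the
symmetries `S_x : y ↦ x ◃ y`. -/
def Rack.Inn (X : Type u) [Rack X] : Subgroup (Equiv.Perm X) :=
  Subgroup.closure (Set.range (Rack.act' : X → Equiv.Perm X))

/-! ### Free products (coproducts) of quandles -/

namespace Quandle

/-- Formal quandle words in the elements of the quandles `X i`. -/
inductive FreeProdWord {ι : Type v} (X : ι → Type u) : Type (max u v)
  | of (i : ι) (x : X i) : FreeProdWord X
  | act (a b : FreeProdWord X) : FreeProdWord X
  | invAct (a b : FreeProdWord X) : FreeProdWord X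

/-- The smallest congruence on formal words that forces the quandle axioms and the operations of
the individual quandles `X i`. -/
inductive FreeProdRel {ι : Type v} (X : ι → Type u) [∀ i, Quandle (X i)] :
    FreeProdWord X → FreeProdWord X → Prop
  | refl (a) : FreeProdRel X a a
  | symm {a b} : FreeProdRel X a b → FreeProdRel X b a
  | trans {a b c} : FreeProdRel X a b → FreeProdRel X b c → FreeProdRel X a c
  | act_congr {a a' b b'} : FreeProdRel X a a' → FreeProdRel X b b' →
      FreeProdRel X (.act a b) (.act a' b')
  | invAct_congr {a a' b b'} : FreeProdRel X a a' → FreeProdRel X b b' →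
      FreeProdRel X (.invAct a b) (.invAct a' b')
  | self_distrib (a b c) :
      FreeProdRel X (.act a (.act b c)) (.act (.act a b) (.act a c))
  | left_inv (a b) : FreeProdRel X (.invAct a (.act a b)) b
  | right_inv (a b) : FreeProdRel X (.act a (.invAct a b)) b
  | fix (a) : FreeProdRel X (.act a a) a
  | of_act (i) (x y : X i) : FreeProdRel X (.of i (x ◃ y)) (.act (.of i x) (.of i y))

/-- The congruence `FreeProdRel` as a setoid. -/
def freeProdSetoid {ι : Type v} (X : ι → Type u) [∀ i, Quandle (X i)] :
    Setoid (FreeProdWord X) where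
  r := FreeProdRel X
  iseqv := ⟨.refl, .symm, .trans⟩

/-- The free product of a family of quandles. -/
def FreeProd {ι : Type v} (X : ι → Type u) [∀ i, Quandle (X i)] : Type (max u v) :=
  Quotient (freeProdSetoid X)

namespace FreeProd

instance instQuandle {ι : Type v} (X : ι → Type u) [∀ i, Quandle (X i)] :
    Quandle (FreeProd X) where
  act := Quotient.map₂ FreeProdWord.act fun _ _ ha _ _ hb => .act_congr ha hb
  invAct := Quotient.map₂ FreeProdWord.invAct fun _ _ ha _ _ hb => .invAct_congr ha hb
  self_distrib := by
    rintro ⟨a⟩ ⟨b⟩ ⟨c⟩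
    exact Quotient.sound (FreeProdRel.self_distrib a b c)
  left_inv := by
    rintro ⟨a⟩ ⟨b⟩
    exact Quotient.sound (FreeProdRel.left_inv a b)
  right_inv := by
    rintro ⟨a⟩ ⟨b⟩
    exact Quotient.sound (FreeProdRel.right_inv a b)
  fix := by
    rintro ⟨a⟩
    exact Quotient.sound (FreeProdRel.fix a)

/-- The element of the free product represented by a formal word. -/
def mk {ι : Type v} {X : ι → Type u} [∀ i, Quandle (X i)] (a : FreeProdWord X) : FreeProd X :=
  Quotient.mk (freeProdSetoid X) a

/-- The canonical homomorphism from a factor to the free product. -/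
def incl {ι : Type v} (X : ι → Type u) [∀ i, Quandle (X i)] (i : ι) : X i →◃ FreeProd X where
  toFun x := mk (.of i x)
  map_act' := fun {x y} => Quotient.sound (FreeProdRel.of_act i x y)

/-- Evaluation of a formal word in a quandle `Y`. -/
def evalWord {ι : Type v} {X : ι → Type u} [∀ i, Quandle (X i)] {Y : Type w} [Quandle Y]
    (f : ∀ i, X i →◃ Y) : FreeProdWord X → Y
  | .of i x => f i x
  | .act a b => evalWord f a ◃ evalWord f b
  | .invAct a b => evalWord f a ◃⁻¹ evalWord f b

theorem evalWord_rel {ι : Type v} {X : ι → Type u} [∀ i, Quandle (X i)] {Y : Type w} [Quandle Y]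
    (f : ∀ i, X i →◃ Y) {a b : FreeProdWord X} (h : FreeProdRel X a b) :
    evalWord f a = evalWord f b := by
  induction h with
  | refl a => rfl
  | symm _ ih => exact ih.symm
  | trans _ _ ih₁ ih₂ => exact ih₁.trans ih₂
  | act_congr _ _ ih₁ ih₂ => simp only [evalWord, ih₁, ih₂]
  | invAct_congr _ _ ih₁ ih₂ => simp only [evalWord, ih₁, ih₂]
  | self_distrib a b c => exact Shelf.self_distrib
  | left_inv a b => exact Rack.left_inv _ _
  | right_inv a b => exact Rack.right_inv _ _
  | fix a => exact Quandle.fix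
  | of_act i x y => exact (f i).map_act

/-- The homomorphism out of the free product induced by homomorphisms out of the factors. -/
def lift {ι : Type v} {X : ι → Type u} [∀ i, Quandle (X i)] {Y : Type w} [Quandle Y]
    (f : ∀ i, X i →◃ Y) : FreeProd X →◃ Y where
  toFun := Quotient.lift (evalWord f) fun _ _ h => evalWord_rel f h
  map_act' := by
    rintro ⟨a⟩ ⟨b⟩
    rfl

/-- The free product is the coproduct in the category of quandles. -/
theorem existsUnique_lift {ι : Type v} {X : ι → Type u} [∀ i, Quandle (X i)] {Y : Type w}
    [Quandle Y] (f : ∀ i, X i →◃ Y) :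
    ∃! F : FreeProd X →◃ Y, ∀ (i : ι) (x : X i), F (incl X i x) = f i x := by
  refine ⟨lift f, fun _ _ => rfl, fun F hF => ?_⟩
  have key : ∀ a : FreeProdWord X, F (mk a) = evalWord f a := by
    intro a
    induction a with
    | of i x => exact hF i x
    | act a b iha ihb =>
      have h := F.map_act (x := mk a) (y := mk b)
      rw [iha, ihb] at h
      exact h
    | invAct a b iha ihb =>
      have h := F.map_act (x := mk a) (y := mk (.invAct a b))
      have e : mk a ◃ mk (.invAct a b) = mk b := Quotient.sound (FreeProdRel.right_inv a b)
      rw [e, iha, ihb] at h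
      change _ = evalWord f a ◃⁻¹ evalWord f b
      rw [h]
      exact (Rack.left_inv _ _).symm
  apply ShelfHom.ext
  funext z
  induction z using Quotient.inductionOn with
  | h a => exact key a

end FreeProd

/-! ### Bounded quandle cohomology with real coefficients -/

/-- The two faces of a tuple that correspond to its `i`-th entry: `face₀` omits `x i`. -/
def face₀ {X : Type u} {n : ℕ} (i : Fin (n + 1)) (x : Fin (n + 1) → X) : Fin n → X :=
  fun j => x (i.succAbove j)

/-- `face₁` omits `x i` and acts with `x i` on all entries that precede it. -/
def face₁ {X : Type u} [Quandle X] {n : ℕ} (i : Fin (n + 1)) (x : Fin (n + 1) → X) : Fin n → X :=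
  fun j => if j.castSucc < i then x i ◃ x (i.succAbove j) else x (i.succAbove j)

/-- The rack coboundary `C^n(X, ℝ) → C^{n+1}(X, ℝ)`. The exponent is `i + 1` because entries are
numbered from `0` here: the first entry carries the sign `-1`. -/
def coboundary (X : Type u) [Quandle X] (n : ℕ) :
    ((Fin n → X) → ℝ) →ₗ[ℝ] ((Fin (n + 1) → X) → ℝ) where
  toFun f x := ∑ i : Fin (n + 1), (-1 : ℝ) ^ ((i : ℕ) + 1) * (f (face₀ i x) - f (face₁ i x))
  map_add' f g := by
    funext x
    simp only [Pi.add_apply]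
    rw [← Finset.sum_add_distrib]
    exact Finset.sum_congr rfl fun i _ => by ring
  map_smul' c f := by
    funext x
    simp only [Pi.smul_apply, smul_eq_mul, RingHom.id_apply]
    rw [Finset.mul_sum]
    exact Finset.sum_congr rfl fun i _ => by ring

/-- Bounded quandle `n`-cochains: bounded functions `X^n → ℝ` that vanish on every tuple in which
two neighbouring entries coincide (for `n ≤ 1` there are no such tuples). -/
def boundedCochains (X : Type u) [Quandle X] (n : ℕ) : Submodule ℝ ((Fin n → X) → ℝ) where
  carrier := {f | (∃ C : ℝ, ∀ x, |f x| ≤ C) ∧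
    ∀ x : Fin n → X, (∃ i j : Fin n, (i : ℕ) + 1 = j ∧ x i = x j) → f x = 0}
  zero_mem' := ⟨⟨0, fun _ => by simp⟩, fun _ _ => rfl⟩
  add_mem' := by
    rintro f g ⟨⟨C, hC⟩, hf⟩ ⟨⟨D, hD⟩, hg⟩
    exact ⟨⟨C + D, fun x => (abs_add_le _ _).trans (add_le_add (hC x) (hD x))⟩,
      fun x hx => by simp [hf x hx, hg x hx]⟩
  smul_mem' := by
    rintro c f ⟨⟨C, hC⟩, hf⟩
    exact ⟨⟨|c| * C, fun x => by
      simpa [abs_mul] using mul_le_mul_of_nonneg_left (hC x) (abs_nonneg c)⟩,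
      fun x hx => by simp [hf x hx]⟩

/-- Bounded quandle `n`-cocycles. -/
def boundedCocycles (X : Type u) [Quandle X] (n : ℕ) : Submodule ℝ ((Fin n → X) → ℝ) :=
  boundedCochains X n ⊓ LinearMap.ker (coboundary X n)

/-- Bounded quandle `n`-coboundaries: coboundaries of bounded quandle `(n - 1)`-cochains. -/
def boundedCoboundaries (X : Type u) [Quandle X] : (n : ℕ) → Submodule ℝ ((Fin n → X) → ℝ)
  | 0 => ⊥
  | n + 1 => (boundedCochains X n).map (coboundary X n)

/-- The bounded quandle cohomology `H^n_b(X, ℝ)`. -/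
abbrev BoundedCohomology (X : Type u) [Quandle X] (n : ℕ) : Type u :=
  boundedCocycles X n ⧸ (boundedCoboundaries X n).submoduleOf (boundedCocycles X n)

end Quandle

/-!
If `f : X → ℝ` varies boundedly along the quandle action, then `δf` is a bounded `2`-cocycle, and
it bounds in bounded cohomology only if `f` is a bounded function plus an invariant one; in that
case `f` is bounded on every `Inn X`-orbit. If `h` varies boundedly along the action, then so
do the powers `|h| ^ p` with `0 < p ≤ 1`. If moreover `h` is unbounded on an orbit, then so is every
nontrivial linear combination of these powers, because the largest exponent dominates. Hence their
classes are linearly independent.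

For a free product, send one factor to the integer `0` and all others to a symbol that acts on the
integers by the unit shift. The induced integer valued function changes by at most one under
the action and is unbounded on the orbit of an element of the chosen factor.
-/

open Asymptotics Filter Quandle

theorem eq_zero_of_sum_smul_isBigO_one {𝕜 E α ι : Type*} [NormedField 𝕜] [NormedAddCommGroup E]
    [NormedSpace 𝕜 E] [LinearOrder ι] {l : Filter α} [l.NeBot] {f : ι → α → E}
    (hone : ∀ i, (fun _ => (1 : ℝ)) =o[l] f i)
    (hlt : ∀ i j, i < j → f i =o[l] f j) {c : ι → 𝕜} {s : Finset ι}
    (h : (∑ i ∈ s, c i • f i) =O[l] fun _ => (1 : ℝ)) : ∀ i ∈ s, c i = 0 := by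
  induction s using Finset.induction_on_max with
  | empty => simp only [Finset.notMem_empty, false_imp_iff, implies_true]
  | insert j s hj ih =>
    rw [Finset.sum_insert fun hjs => lt_irrefl j (hj j hjs)] at h
    have hlower : (∑ i ∈ s, c i • f i) =o[l] f j :=
      IsLittleO.sum fun i hi => (hlt i j (hj i hi)).const_smul_left (c i)
    have hcj : c j = 0 := by
      by_contra hne
      have hself : (c j • f j) =o[l] f j :=
        ((h.trans_isLittleO (hone j)).sub hlower).congr_left fun _ => add_sub_cancel_right _ _
      have hf : ∀ᶠ x in l, f j x ≠ 0 :=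
        (hone j).isBigO.eq_zero_imp.mono fun _ hx => mt hx one_ne_zero
      exact isLittleO_irrefl hf.frequently ((isLittleO_const_smul_left hne).1 hself)
    rw [hcj, zero_smul, zero_add] at h
    exact (Finset.forall_mem_insert _ _ _).2 ⟨hcj, ih h⟩

theorem isLittleO_rpow_rpow_atTop {p q : ℝ} (hpq : p < q) :
    (fun t : ℝ => t ^ p) =o[atTop] fun t => t ^ q := by
  have hpos : ∀ᶠ t : ℝ in atTop, 0 < t := eventually_gt_atTop 0
  rw [isLittleO_iff_tendsto' (hpos.mono fun t ht h => absurd h (Real.rpow_pos_of_pos ht q).ne')]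
  refine (tendsto_rpow_neg_atTop (sub_pos.2 hpq)).congr' (hpos.mono fun t ht => ?_)
  rw [neg_sub, Real.rpow_sub ht]

theorem eq_zero_of_abs_sum_mul_abs_rpow_le {α ι : Type*} [LinearOrder ι] {h : α → ℝ} {S : Set α}
    (hS : ¬ Bornology.IsBounded (h '' S)) {p : ι → ℝ} (hp : StrictMono p) (hpos : ∀ i, 0 < p i)
    {c : ι → ℝ} {s : Finset ι} {C : ℝ} (hC : ∀ y ∈ S, |∑ i ∈ s, c i * |h y| ^ p i| ≤ C) :
    ∀ i ∈ s, c i = 0 := by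
  let l : Filter α := comap h (Bornology.cobounded ℝ) ⊓ 𝓟 S
  have hl : l.NeBot := neBot_inf_comap_iff_map'.2 <| by
    rw [map_principal, ← frequently_mem_iff_neBot]
    exact fun hev => hS (Bornology.isBounded_def.2 hev)
  have habs : Tendsto (fun y => |h y|) l atTop :=
    tendsto_norm_cobounded_atTop.comp (tendsto_comap.mono_left inf_le_left)
  have hlt {q r : ℝ} (hqr : q < r) : (fun y => |h y| ^ q) =o[l] fun y => |h y| ^ r :=
    (isLittleO_rpow_rpow_atTop hqr).comp_tendsto habs
  have hbdd : (∑ i ∈ s, c i • fun y => |h y| ^ p i) =O[l] fun _ => (1 : ℝ) :=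
    IsBigO.of_bound C (mem_inf_of_right fun y hy => by simpa using hC y hy)
  exact eq_zero_of_sum_smul_isBigO_one
    (fun i => by simpa only [Real.rpow_zero] using hlt (hpos i)) (fun i j hij => hlt (hp hij)) hbdd

theorem abs_abs_rpow_sub_abs_rpow_le {p : ℝ} (hp₀ : 0 ≤ p) (hp₁ : p ≤ 1) (a b : ℝ) :
    |(|a| ^ p - |b| ^ p)| ≤ |a - b| ^ p := by
  have key (a b : ℝ) : |a| ^ p ≤ |a - b| ^ p + |b| ^ p :=
    calc |a| ^ p ≤ (|a - b| + |b|) ^ p := by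
          gcongr
          simpa only [sub_add_cancel] using abs_add_le (a - b) b
      _ ≤ |a - b| ^ p + |b| ^ p :=
          Real.rpow_add_le_add_rpow (abs_nonneg _) (abs_nonneg _) hp₀ hp₁
  rw [abs_sub_le_iff, sub_le_iff_le_add, sub_le_iff_le_add]
  exact ⟨key a b, abs_sub_comm a b ▸ key b a⟩

section QuasiInvariant

variable (X : Type*) [Shelf X]

/-- Quasi-invariant functions on a shelf, that is, functions that change by a bounded amount
under the action of a single element. On a quandle they are the `1`-cochains whose coboundary is
bounded. -/
def quasiInvariant : Submodule ℝ (X → ℝ) where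
  carrier := {f | ∃ C : ℝ, ∀ x y, |f x - f (y ◃ x)| ≤ C}
  zero_mem' := ⟨0, by simp⟩
  add_mem' := by
    rintro f g ⟨C, hC⟩ ⟨D, hD⟩
    refine ⟨C + D, fun x y => ?_⟩
    rw [Pi.add_apply, Pi.add_apply, add_sub_add_comm]
    exact (abs_add_le _ _).trans (add_le_add (hC x y) (hD x y))
  smul_mem' := by
    rintro c f ⟨C, hC⟩
    refine ⟨|c| * C, fun x y => ?_⟩
    rw [Pi.smul_apply, Pi.smul_apply, ← smul_sub, smul_eq_mul, abs_mul]
    exact mul_le_mul_of_nonneg_left (hC x y) (abs_nonneg c)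

variable {X}

theorem abs_rpow_mem_quasiInvariant {h : X → ℝ} (hh : h ∈ quasiInvariant X) {p : ℝ} (hp₀ : 0 ≤ p)
    (hp₁ : p ≤ 1) : (fun x => |h x| ^ p) ∈ quasiInvariant X := by
  obtain ⟨C, hC⟩ := hh
  refine ⟨C ^ p, fun x y => (abs_abs_rpow_sub_abs_rpow_le hp₀ hp₁ _ _).trans ?_⟩
  gcongr
  exact hC x y

theorem comp_mem_quasiInvariant {Y : Type*} [Shelf Y] {h : Y → ℝ} (hh : h ∈ quasiInvariant Y)
    (F : X →◃ Y) : h ∘ F ∈ quasiInvariant X := by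
  obtain ⟨C, hC⟩ := hh
  refine ⟨C, fun x y => ?_⟩
  simpa only [Function.comp_apply, F.map_act] using hC (F x) (F y)

end QuasiInvariant

section CoboundaryClass

variable {X : Type*} [Quandle X]

theorem coboundary_one_apply (f : (Fin 1 → X) → ℝ) (x : Fin 2 → X) :
    coboundary X 1 f x = f (fun _ => x 0) - f (fun _ => x 1 ◃ x 0) := by
  have face₀_zero : face₀ 0 x = fun _ => x 1 := funext fun j => by fin_cases j; rfl
  have face₁_zero : face₁ 0 x = fun _ => x 1 := funext fun j => by fin_cases j; rfl
  have face₀_one : face₀ 1 x = fun _ => x 0 := funext fun j => by fin_cases j; rfl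
  have face₁_one : face₁ 1 x = fun _ => x 1 ◃ x 0 := funext fun j => by fin_cases j; rfl
  simp [coboundary, face₀_zero, face₁_zero, face₀_one, face₁_one]

theorem coboundary_two_apply (f : (Fin 2 → X) → ℝ) (x : Fin 3 → X) :
    coboundary X 2 f x = f ![x 0, x 2] - f ![x 1 ◃ x 0, x 2] -
      (f ![x 0, x 1] - f ![x 2 ◃ x 0, x 2 ◃ x 1]) := by
  have faces_zero : face₀ 0 x = face₁ 0 x := rfl
  have face₀_one : face₀ 1 x = ![x 0, x 2] := funext fun j => by fin_cases j <;> rfl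
  have face₁_one : face₁ 1 x = ![x 1 ◃ x 0, x 2] := funext fun j => by fin_cases j <;> rfl
  have face₀_two : face₀ 2 x = ![x 0, x 1] := funext fun j => by fin_cases j <;> rfl
  have face₁_two : face₁ 2 x = ![x 2 ◃ x 0, x 2 ◃ x 1] := funext fun j => by fin_cases j <;> rfl
  rw [coboundary, LinearMap.coe_mk, AddHom.coe_mk, Fin.sum_univ_three, faces_zero, face₀_one,
    face₁_one, face₀_two, face₁_two]
  simp only [Fin.val_zero, Fin.val_one, Fin.val_two]
  ring

theorem coboundary_two_coboundary_one (f : (Fin 1 → X) → ℝ) :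
    coboundary X 2 (coboundary X 1 f) = 0 := by
  funext x
  have hdistrib : x 2 ◃ (x 1 ◃ x 0) = (x 2 ◃ x 1) ◃ (x 2 ◃ x 0) := Shelf.self_distrib
  simp only [coboundary_two_apply, coboundary_one_apply, Matrix.cons_val_zero,
    Matrix.cons_val_one, hdistrib, Pi.zero_apply]
  ring

theorem coboundary_one_mem_boundedCocycles {f : X → ℝ} (hf : f ∈ quasiInvariant X) :
    coboundary X 1 (fun x => f (x 0)) ∈ boundedCocycles X 2 := by
  obtain ⟨C, hC⟩ := hf
  refine ⟨⟨⟨C, fun x => ?_⟩, ?_⟩, coboundary_two_coboundary_one _⟩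
  · rw [coboundary_one_apply]
    exact hC (x 0) (x 1)
  · rintro x ⟨i, j, hij, hx⟩
    obtain rfl : i = 0 := by omega
    obtain rfl : j = 1 := by omega
    rw [coboundary_one_apply, ← hx, Quandle.fix, sub_self]

variable (X) in
/-- The class in the second bounded cohomology of the coboundary of a quasi-invariant function. -/
def coboundaryClass : quasiInvariant X →ₗ[ℝ] BoundedCohomology X 2 :=
  Submodule.mkQ _ ∘ₗ
    (coboundary X 1 ∘ₗ LinearMap.funLeft ℝ ℝ fun x : Fin 1 → X => x 0).restrict
      fun _ => coboundary_one_mem_boundedCocycles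

theorem exists_bounded_sub_invariant_of_coboundaryClass_eq_zero {f : quasiInvariant X}
    (hf : coboundaryClass X f = 0) :
    ∃ g : X → ℝ, (∃ C : ℝ, ∀ x, |g x| ≤ C) ∧ ∀ x y, (f.1 - g) (y ◃ x) = (f.1 - g) x := by
  obtain ⟨g, ⟨⟨C, hC⟩, -⟩, hg⟩ := (Submodule.Quotient.mk_eq_zero _).1 hf
  refine ⟨fun x => g fun _ => x, ⟨C, fun x => hC _⟩, fun x y => ?_⟩
  have hδ : g (fun _ => x) - g (fun _ => y ◃ x) = f.1 x - f.1 (y ◃ x) := by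
    have h := congrFun hg ![x, y]
    rw [coboundary_one_apply] at h
    exact h.trans (coboundary_one_apply _ _)
  simp only [Pi.sub_apply]
  linarith

theorem apply_inn_smul_of_invariant {R α : Type*} [Rack R] {f : R → α}
    (hf : ∀ x y, f (y ◃ x) = f x) (φ : Rack.Inn R) (x : R) : f (φ • x) = f x := by
  obtain ⟨φ, hφ⟩ := φ
  change f (φ x) = f x
  induction hφ using Subgroup.closure_induction generalizing x with
  | mem _ h =>
    obtain ⟨y, rfl⟩ := h
    exact hf x y
  | one => rfl
  | mul φ ψ _ _ ihφ ihψ => exact (ihφ (ψ x)).trans (ihψ x)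
  | inv φ _ ih => exact (ih (φ⁻¹ x)).symm.trans (congrArg f (φ.apply_symm_apply x))

theorem exists_abs_le_on_orbit_of_coboundaryClass_eq_zero {f : quasiInvariant X}
    (hf : coboundaryClass X f = 0) (x : X) :
    ∃ C : ℝ, ∀ y ∈ MulAction.orbit (Rack.Inn X) x, |f.1 y| ≤ C := by
  obtain ⟨g, ⟨C, hC⟩, hinv⟩ := exists_bounded_sub_invariant_of_coboundaryClass_eq_zero hf
  refine ⟨|(f.1 - g) x| + C, ?_⟩
  rintro _ ⟨φ, rfl⟩
  calc |f.1 (φ • x)| = |(f.1 - g) x + g (φ • x)| := by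
        rw [← apply_inn_smul_of_invariant hinv φ x, Pi.sub_apply, sub_add_cancel]
    _ ≤ |(f.1 - g) x| + C := (abs_add_le _ _).trans (by gcongr; exact hC _)

theorem linearIndependent_coboundaryClass_abs_rpow {h : X → ℝ} (hh : h ∈ quasiInvariant X) {x : X}
    (hx : ¬ Bornology.IsBounded (h '' MulAction.orbit (Rack.Inn X) x)) :
    LinearIndependent ℝ fun p : Set.Ioc (0 : ℝ) 1 =>
      coboundaryClass X ⟨_, abs_rpow_mem_quasiInvariant hh p.2.1.le p.2.2⟩ := by
  rw [linearIndependent_iff']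
  intro s c hc
  simp only [← map_smul, ← map_sum] at hc
  obtain ⟨C, hC⟩ := exists_abs_le_on_orbit_of_coboundaryClass_eq_zero hc x
  refine eq_zero_of_abs_sum_mul_abs_rpow_le hx (Subtype.strictMono_coe _) (fun p => p.2.1)
    (C := C) fun y hy => ?_
  simpa using hC y hy

theorem not_finiteDimensional_boundedCohomology_two {h : X → ℝ} (hh : h ∈ quasiInvariant X)
    {x : X} (hx : ¬ Bornology.IsBounded (h '' MulAction.orbit (Rack.Inn X) x)) :
    ¬ FiniteDimensional ℝ (BoundedCohomology X 2) := fun _ =>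
  have : Infinite (Set.Ioc (0 : ℝ) 1) := (Set.Ioc_infinite one_pos).to_subtype
  Module.Finite.not_linearIndependent_of_infinite _
    (linearIndependent_coboundaryClass_abs_rpow hh hx)

end CoboundaryClass

/-- The integers together with a symbol `shift` that acts on the integers by the unit translation;
all other actions are trivial. It is the target on which the unboundedness of orbits in a free
product is detected. -/
inductive ShiftQuandle
  | int (n : ℤ)
  | shift

namespace ShiftQuandle

instance : Quandle ShiftQuandle where
  act
    | shift, int n => int (n + 1)
    | _, a => a
  invAct
    | shift, int n => int (n - 1)
    | _, a => a
  self_distrib := by rintro (_ | _) (_ | _) (_ | _) <;> rfl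
  left_inv := by rintro (_ | _) (_ | _) <;> simp
  right_inv := by rintro (_ | _) (_ | _) <;> simp
  fix := by rintro (_ | _) <;> rfl

theorem shift_act_int (n : ℤ) : shift ◃ int n = int (n + 1) := rfl

/-- The integer underlying an element of the shift quandle, with the arbitrary value `0` at
`shift`, as a real number. -/
def height : ShiftQuandle → ℝ
  | int n => n
  | shift => 0

theorem height_mem_quasiInvariant : height ∈ quasiInvariant ShiftQuandle := by
  refine ⟨1, ?_⟩
  rintro (n | _) (_ | _)
  case int.shift => simp [shift_act_int, height]
  all_goals exact (abs_nonpos_iff.2 (sub_self _)).trans zero_le_one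

end ShiftQuandle

section FreeProduct

variable {ι : Type*} (X : ι → Type*) [∀ i, Quandle (X i)]

open ShiftQuandle

open Classical in
/-- The homomorphism from a free product to the shift quandle that sends the factor `i` to the
integer `0` and every other factor to `shift`. -/
noncomputable def freeProdToShift (i : ι) : FreeProd X →◃ ShiftQuandle :=
  FreeProd.lift fun j =>
    { toFun := fun _ => if j = i then int 0 else shift
      map_act' := Quandle.fix.symm }

variable {X} {i j : ι}

theorem freeProdToShift_incl_self (x : X i) : freeProdToShift X i (FreeProd.incl X i x) = int 0 :=
  if_pos rfl

theorem freeProdToShift_incl_of_ne (hij : i ≠ j) (y : X j) :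
    freeProdToShift X i (FreeProd.incl X j y) = shift :=
  if_neg hij.symm

theorem freeProdToShift_act'_pow_incl (hij : i ≠ j) (x : X i) (y : X j) (n : ℕ) :
    freeProdToShift X i ((Rack.act' (FreeProd.incl X j y) ^ n) (FreeProd.incl X i x)) = int n := by
  induction n with
  | zero => exact freeProdToShift_incl_self x
  | succ n ih =>
    rw [pow_succ', Equiv.Perm.mul_apply, Rack.act'_apply, ShelfHom.map_act, ih,
      freeProdToShift_incl_of_ne hij, shift_act_int, Nat.cast_succ]

theorem not_isBounded_height_image_orbit_incl (hij : i ≠ j) [Nonempty (X j)] (x : X i) :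
    ¬ Bornology.IsBounded ((height ∘ freeProdToShift X i) ''
      MulAction.orbit (Rack.Inn (FreeProd X)) (FreeProd.incl X i x)) := by
  obtain ⟨y⟩ := ‹Nonempty (X j)›
  intro hbdd
  obtain ⟨C, hC⟩ := hbdd.exists_norm_le
  obtain ⟨n, hn⟩ := exists_nat_gt C
  let φ : Rack.Inn (FreeProd X) :=
    ⟨Rack.act' (FreeProd.incl X j y), Subgroup.subset_closure (Set.mem_range_self _)⟩
  have hheight : height (freeProdToShift X i (φ ^ n • FreeProd.incl X i x)) = n :=
    congrArg height (freeProdToShift_act'_pow_incl hij x y n)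
  have hle : ‖(n : ℝ)‖ ≤ C :=
    hC n ⟨_, MulAction.mem_orbit _ (φ ^ n), hheight⟩
  exact hn.not_ge ((le_abs_self _).trans hle)

variable (X) in
theorem mainTheorem6_general (hij : i ≠ j) [Nonempty (X i)] [Nonempty (X j)] :
    ¬ FiniteDimensional ℝ (BoundedCohomology (FreeProd X) 2) := by
  obtain ⟨x⟩ := ‹Nonempty (X i)›
  exact not_finiteDimensional_boundedCohomology_two
    (comp_mem_quasiInvariant height_mem_quasiInvariant (freeProdToShift X i))
    (not_isBounded_height_image_orbit_incl hij x)

end FreeProduct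

theorem mainTheorem6 {m : ℕ} (hm : 2 ≤ m) (X : Fin m → Type u) [∀ i, Quandle (X i)]
    [∀ i, Nonempty (X i)] (hX : ∃ i, IsAmenableGroup (Rack.Inn (X i))) :
    ¬ FiniteDimensional ℝ (Quandle.BoundedCohomology (Quandle.FreeProd X) 2) := by
  exact mainTheorem6_general X (i := ⟨0, by omega⟩) (j := ⟨1, by omega⟩) (by simp)
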